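/- Let $d$ be a natural number. Let $\mathcal{G}_d$ be the unit distance graph of $\mathbb{R}^d$: its vertex set is $\mathbb{R}^d$, and two points are joined by an edge precisely when their Euclidean distance is $1$. For $X \subseteq \mathbb{R}^d$ let $\mathcal{G}_d[X]$ be the subgraph induced by $X$, and let $r(X)$ be the radius of the minimal enclosing ball of $X$, that is, the smallest $r \ge 0$ such that $X$ is contained in a closed ball of radius $r$, with $r(X) = \infty$ if $X$ is unbounded. Let $X \subseteq \mathbb{R}^d$ be a nonempty convex set, not necessarily closed or bounded. If $r(X) = 0$, or if $r(X) > 1$ and $X$ contains three affinely independent points, then the graph $\mathcal{G}_d[X]$ is connected. -/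

import Mathlib

open scoped NNReal ENNReal

/-- The unit distance graph of `ℝ^d`: the vertices are the points of Euclidean `d`-space, and two
points are adjacent when their Euclidean distance is `1`. -/
def unitDistanceGraph (d : ℕ) : SimpleGraph (EuclideanSpace ℝ (Fin d)) where
  Adj x y := dist x y = 1
  symm := ⟨fun x y h => by rw [dist_comm]; exact h⟩
  loopless := ⟨fun x h => by simp at h⟩

/-- The radius `r(X)`: the least radius of a closed ball containing `X`. It is `∞` when `X` is
unbounded, that is, when no ball contains `X`. -/
noncomputable def enclosingRadius {d : ℕ} (X : Set (EuclideanSpace ℝ (Fin d))) : ℝ≥0∞ :=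
  ⨅ (v : EuclideanSpace ℝ (Fin d)) (r : ℝ≥0) (_ : X ⊆ Metric.closedBall v (r : ℝ)), (r : ℝ≥0∞)

/-- If `X` has a minimal enclosing ball, its radius is `enclosingRadius X`. -/
theorem enclosingRadius_eq_of_minimal {d : ℕ} {X : Set (EuclideanSpace ℝ (Fin d))}
    {v : EuclideanSpace ℝ (Fin d)} {r : ℝ≥0} (hX : X ⊆ Metric.closedBall v (r : ℝ))
    (hmin : ∀ (w : EuclideanSpace ℝ (Fin d)) (s : ℝ≥0),
      X ⊆ Metric.closedBall w (s : ℝ) → r ≤ s) :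
    enclosingRadius X = r := by
  refine le_antisymm (iInf_le_of_le v (iInf₂_le r hX)) ?_
  exact le_iInf fun w => le_iInf₂ fun s hs => ENNReal.coe_le_coe.2 (hmin w s hs)

/-! If r(X) = 0, X is a single point. Otherwise work inside the affine span, where X has nonempty
interior and the dimension is at least 2. No closed unit ball centred in X contains X, so convexity
gives every point of X a unit neighbour in the interior (`Convex.exists_mem_interior_dist_eq_one`).
The interior is connected, so it suffices that an interior point y reaches all nearby points
(`eventually_rel_of_mem_interior`). A rhombus with diagonal from y to z would do this directly, but
its apex has no limit as z tends to y. The path therefore detours through a fixed point near y but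
distinct from it, displaced orthogonally to the edge from y to its neighbour. -/

/-- Given a unit vector `u` and a displacement `d` of length less than `2` that is not parallel
to `u`, a point at distance `1` from both `0` and `d`, on the side of `u`. -/
noncomputable def rhombusApex {V : Type*} [NormedAddCommGroup V] [InnerProductSpace ℝ V]
    (u d : V) : V :=
  (1 / 2 : ℝ) • d + (√(1 - ‖d‖ ^ 2 / 4) / ‖u - (inner ℝ u d / ‖d‖ ^ 2) • d‖) •
    (u - (inner ℝ u d / ‖d‖ ^ 2) • d)

section RhombusApex

variable {V : Type*} [NormedAddCommGroup V] [InnerProductSpace ℝ V]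

theorem inner_sub_smul_self_eq_zero (u : V) {d : V} (hd : d ≠ 0) :
    inner ℝ d (u - (inner ℝ u d / ‖d‖ ^ 2) • d) = 0 := by
  have h : ‖d‖ ≠ 0 := norm_ne_zero_iff.2 hd
  rw [inner_sub_right, inner_smul_right, real_inner_self_eq_norm_sq, real_inner_comm]
  field_simp
  ring

/-- Pythagoras. The values c = 1/2 and c = -1/2 give the distances from the apex to 0 and to d. -/
theorem norm_half_smul_add_smul_eq_one {d n : V} (hn : n ≠ 0) (h : inner ℝ d n = 0)
    (hd : ‖d‖ ≤ 2) (c : ℝ) (hc : c ^ 2 = 1 / 4) :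
    ‖c • d + (√(1 - ‖d‖ ^ 2 / 4) / ‖n‖) • n‖ = 1 := by
  have hn' : ‖n‖ ≠ 0 := norm_ne_zero_iff.2 hn
  have hs : 0 ≤ 1 - ‖d‖ ^ 2 / 4 := by nlinarith [norm_nonneg d]
  have : ‖c • d + (√(1 - ‖d‖ ^ 2 / 4) / ‖n‖) • n‖ ^ 2 = 1 := by
    rw [norm_add_sq_real, inner_smul_left, inner_smul_right, h, norm_smul, norm_smul, mul_pow,
      mul_pow, Real.norm_eq_abs, Real.norm_eq_abs, sq_abs, sq_abs, div_pow, Real.sq_sqrt hs, hc]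
    field_simp
    simp
    ring
  exact (pow_eq_one_iff_of_nonneg (norm_nonneg _) two_ne_zero).1 this

theorem norm_rhombusApex {u d : V} (hd : d ≠ 0) (hd2 : ‖d‖ ≤ 2)
    (hn : u - (inner ℝ u d / ‖d‖ ^ 2) • d ≠ 0) : ‖rhombusApex u d‖ = 1 :=
  norm_half_smul_add_smul_eq_one hn (inner_sub_smul_self_eq_zero u hd) hd2 _ (by norm_num)

theorem norm_rhombusApex_sub {u d : V} (hd : d ≠ 0) (hd2 : ‖d‖ ≤ 2)
    (hn : u - (inner ℝ u d / ‖d‖ ^ 2) • d ≠ 0) : ‖rhombusApex u d - d‖ = 1 := by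
  rw [← norm_half_smul_add_smul_eq_one hn (inner_sub_smul_self_eq_zero u hd) hd2 (-1 / 2)
    (by norm_num), rhombusApex]
  congr 1
  module

theorem continuousAt_rhombusApex {u d : V} (hd : d ≠ 0)
    (hn : u - (inner ℝ u d / ‖d‖ ^ 2) • d ≠ 0) : ContinuousAt (rhombusApex u) d := by
  have h : ‖d‖ ^ 2 ≠ 0 := pow_ne_zero 2 (norm_ne_zero_iff.2 hd)
  have hN : ContinuousAt (fun d : V => u - (inner ℝ u d / ‖d‖ ^ 2) • d) d := by
    fun_prop (disch := assumption)
  unfold rhombusApex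
  refine ContinuousAt.add (by fun_prop) (ContinuousAt.smul (ContinuousAt.div ?_ hN.norm
    (norm_ne_zero_iff.2 hn)) hN)
  fun_prop

theorem rhombusApex_of_inner_eq_zero {u d : V} (hu : ‖u‖ = 1) (h : inner ℝ u d = 0) :
    rhombusApex u d = (1 / 2 : ℝ) • d + √(1 - ‖d‖ ^ 2 / 4) • u := by
  simp [rhombusApex, h, hu]

end RhombusApex

section Interior

open Filter Topology

variable {V : Type*} [NormedAddCommGroup V] [InnerProductSpace ℝ V]

theorem exists_norm_eq_one_inner_eq_zero (hV : 2 ≤ Module.finrank ℝ V) (u : V) :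
    ∃ e : V, ‖e‖ = 1 ∧ inner ℝ u e = 0 := by
  have hne : (ℝ ∙ u)ᗮ ≠ ⊥ := by
    rw [Ne, Submodule.orthogonal_eq_bot_iff]
    intro h
    have := finrank_span_le_card (R := ℝ) ({u} : Set V)
    rw [h, finrank_top] at this
    simp at this
    omega
  obtain ⟨e, he, he0⟩ := Submodule.exists_mem_ne_zero_of_ne_bot hne
  refine ⟨(‖e‖⁻¹ : ℝ) • e, norm_smul_inv_norm (𝕜 := ℝ) he0, ?_⟩
  rw [inner_smul_right, Submodule.mem_orthogonal_singleton_iff_inner_right.1 he, mul_zero]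

/-- A transitive relation on `V` that contains all unit-distance pairs of `X` is locally
universal near an interior point of `X` that has an interior neighbour. -/
theorem eventually_rel_of_mem_interior (hV : 2 ≤ Module.finrank ℝ V) {X : Set V} {P : V → V → Prop}
    (hP : ∀ x ∈ X, ∀ y ∈ X, dist x y = 1 → P x y) (htrans : ∀ x y z, P x y → P y z → P x z)
    {y w : V} (hy : y ∈ interior X) (hw : w ∈ interior X) (hyw : dist y w = 1) :
    ∀ᶠ z in 𝓝 y, P y z := by
  set u := w - y with hu
  have hu1 : ‖u‖ = 1 := by rw [hu, ← dist_eq_norm, dist_comm, hyw]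
  obtain ⟨e, he, hue⟩ := exists_norm_eq_one_inner_eq_zero hV u
  -- a second interior point `y + s • e` with an interior common neighbour
  have hy2 : ∀ᶠ s : ℝ in 𝓝[>] 0, y + s • e ∈ interior X := by
    have : Tendsto (fun s : ℝ => y + s • e) (𝓝 0) (𝓝 y) := by
      have : Continuous fun s : ℝ => y + s • e := by fun_prop
      simpa using this.tendsto 0
    exact (this.mono_left nhdsWithin_le_nhds).eventually (isOpen_interior.mem_nhds hy)
  have hm : ∀ᶠ s : ℝ in 𝓝[>] 0,
      y + ((1 / 2 : ℝ) • (s • e) + √(1 - ‖s • e‖ ^ 2 / 4) • u) ∈ interior X := by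
    have : Tendsto (fun s : ℝ => y + ((1 / 2 : ℝ) • (s • e) + √(1 - ‖s • e‖ ^ 2 / 4) • u))
        (𝓝 0) (𝓝 w) := by
      have : Continuous fun s : ℝ =>
        y + ((1 / 2 : ℝ) • (s • e) + √(1 - ‖s • e‖ ^ 2 / 4) • u) := by fun_prop
      simpa [hu] using this.tendsto 0
    exact (this.mono_left nhdsWithin_le_nhds).eventually (isOpen_interior.mem_nhds hw)
  have hs2 : ∀ᶠ s : ℝ in 𝓝[>] 0, s < 2 :=
    nhdsWithin_le_nhds (Iio_mem_nhds (by norm_num))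
  obtain ⟨s, hsy, hsm, hs2, hs0 : 0 < s⟩ :=
    (hy2.and (hm.and (hs2.and self_mem_nhdsWithin))).exists
  have hd : s • e ≠ 0 := smul_ne_zero hs0.ne' (norm_ne_zero_iff.1 (by rw [he]; norm_num))
  have hdn : ‖s • e‖ < 2 := by rwa [norm_smul, he, mul_one, Real.norm_of_nonneg hs0.le]
  have hinner : inner ℝ u (s • e) = 0 := by rw [inner_smul_right, hue, mul_zero]
  have hu0 : u ≠ 0 := norm_ne_zero_iff.1 (by rw [hu1]; norm_num)
  have hn : u - (inner ℝ u (s • e) / ‖s • e‖ ^ 2) • (s • e) ≠ 0 := by simpa [hinner] using hu0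
  rw [← rhombusApex_of_inner_eq_zero hu1 hinner] at hsm
  have hbase : P y (y + s • e) := by
    refine htrans _ _ _ (hP y (interior_subset hy) _ (interior_subset hsm) ?_)
      (hP _ (interior_subset hsm) _ (interior_subset hsy) ?_)
    · simpa using norm_rhombusApex hd hdn.le hn
    · rw [dist_add_left, dist_eq_norm]
      exact norm_rhombusApex_sub hd hdn.le hn
  -- the apex over `z` and `y + s • e` depends continuously on `z`
  have hlim : Tendsto (fun z => y + s • e - z) (𝓝 y) (𝓝 (s • e)) := by
    have : Continuous fun z => y + s • e - z := by fun_prop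
    simpa using this.tendsto y
  have hN : ContinuousAt (fun d : V => u - (inner ℝ u d / ‖d‖ ^ 2) • d) (s • e) := by
    have h : ‖s • e‖ ^ 2 ≠ 0 := pow_ne_zero 2 (norm_ne_zero_iff.2 hd)
    fun_prop (disch := assumption)
  have hapex : ∀ᶠ z in 𝓝 y, z + rhombusApex u (y + s • e - z) ∈ interior X :=
    (tendsto_id.add ((continuousAt_rhombusApex hd hn).tendsto.comp hlim)).eventually
      (isOpen_interior.mem_nhds hsm)
  filter_upwards [hapex, isOpen_interior.mem_nhds hy, hlim.eventually_ne hd,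
    hlim.eventually (hN.eventually_ne hn), hlim.norm.eventually_lt_const hdn]
    with z hz hzX hz0 hzn hz2
  refine htrans _ _ _ hbase (htrans _ _ _ (hP _ (interior_subset hsy) _ (interior_subset hz) ?_)
    (hP _ (interior_subset hz) _ (interior_subset hzX) ?_))
  · rw [dist_comm, dist_eq_norm, ← norm_rhombusApex_sub hz0 hz2.le hzn]
    congr 1
    abel
  · simpa using norm_rhombusApex hz0 hz2.le hzn

/-- Interior points are dense in X, so z may be moved into the interior while staying farther than 1
from x; the open segment from x to it is then interior. -/
theorem Convex.exists_mem_interior_dist_eq_one {X : Set V} (hX : Convex ℝ X)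
    (hint : (interior X).Nonempty) {x z : V} (hx : x ∈ X) (hz : z ∈ X) (hxz : 1 < dist x z) :
    ∃ y ∈ interior X, dist x y = 1 := by
  have hcl : z ∈ closure (interior X) := by
    rw [hX.closure_interior_eq_closure_of_nonempty_interior hint]
    exact subset_closure hz
  have hopen : IsOpen {z | 1 < dist x z} := isOpen_lt continuous_const (by fun_prop)
  obtain ⟨z', hz' : 1 < dist x z', hz'X⟩ := mem_closure_iff.1 hcl _ hopen hxz
  have hpos : 0 < dist x z' := one_pos.trans hz'
  refine ⟨AffineMap.lineMap x z' (dist x z')⁻¹,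
    hX.openSegment_self_interior_subset_interior hx hz'X ?_, ?_⟩
  · rw [openSegment_eq_image_lineMap]
    exact ⟨_, ⟨inv_pos.2 hpos, inv_lt_one_of_one_lt₀ hz'⟩, rfl⟩
  · rw [dist_left_lineMap, Real.norm_of_nonneg (inv_pos.2 hpos).le, inv_mul_cancel₀ hpos.ne']

/-- A symmetric transitive relation containing all unit-distance pairs of a convex set `X` with nonempty
interior is universal on `X` if `X` lies in no closed unit ball centred at one of its points. -/
theorem Convex.rel_of_dist_eq_one (hV : 2 ≤ Module.finrank ℝ V) {X : Set V} (hX : Convex ℝ X)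
    (hint : (interior X).Nonempty) (hfar : ∀ x ∈ X, ∃ z ∈ X, 1 < dist x z) {P : V → V → Prop}
    (hP : ∀ x ∈ X, ∀ y ∈ X, dist x y = 1 → P x y) (hsymm : ∀ x y, P x y → P y x)
    (htrans : ∀ x y z, P x y → P y z → P x z) {x y : V} (hx : x ∈ X) (hy : y ∈ X) : P x y := by
  have hnbr : ∀ x ∈ X, ∃ y ∈ interior X, dist x y = 1 := fun x hx => by
    obtain ⟨z, hz, hxz⟩ := hfar x hx
    exact hX.exists_mem_interior_dist_eq_one hint hx hz hxz
  have hinterior : ∀ x ∈ interior X, ∀ y ∈ interior X, P x y := fun x hx y hy =>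
    hX.interior.isPreconnected.induction₂ P (fun x hx => by
      obtain ⟨w, hw, hxw⟩ := hnbr x (interior_subset hx)
      exact nhdsWithin_le_nhds (eventually_rel_of_mem_interior hV hP htrans hx hw hxw))
      (fun x y z _ _ _ => htrans x y z) (fun x y _ _ => hsymm x y) hx hy
  obtain ⟨x', hx', hxx'⟩ := hnbr x hx
  obtain ⟨y', hy', hyy'⟩ := hnbr y hy
  exact htrans _ _ _ (hP x hx x' (interior_subset hx') hxx') (htrans _ _ _
    (hinterior x' hx' y' hy') (hsymm _ _ (hP y hy y' (interior_subset hy') hyy')))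

end Interior

section EnclosingRadius

variable {d : ℕ} {X : Set (EuclideanSpace ℝ (Fin d))}

theorem subsingleton_of_enclosingRadius_eq_zero (h : enclosingRadius X = 0) :
    X.Subsingleton := by
  intro x hx y hy
  refine dist_le_zero.1 (le_of_forall_pos_le_add fun ε hε => ?_)
  have hlt : enclosingRadius X < ENNReal.ofReal (ε / 2) := by
    rw [h]; exact ENNReal.ofReal_pos.2 (by positivity)
  simp only [enclosingRadius, iInf_lt_iff] at hlt
  obtain ⟨v, r, hX, hr⟩ := hlt
  have hr' : (r : ℝ) < ε / 2 := by
    rw [ENNReal.ofReal, ENNReal.coe_lt_coe] at hr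
    exact (Real.lt_toNNReal_iff_coe_lt).1 hr
  have h1 : dist x v ≤ r := hX hx
  have h2 : dist y v ≤ r := hX hy
  linarith [dist_triangle_right x y v]

theorem exists_one_lt_dist_of_one_lt_enclosingRadius (h : 1 < enclosingRadius X)
    (x : EuclideanSpace ℝ (Fin d)) : ∃ z ∈ X, 1 < dist x z := by
  by_contra! hle
  refine h.not_ge (iInf_le_of_le x (iInf₂_le_of_le 1 (fun z hz => ?_) (by simp)))
  simpa [dist_comm] using hle z hz

end EnclosingRadius

theorem mainTheorem6 (d : ℕ) (X : Set (EuclideanSpace ℝ (Fin d))) (hne : X.Nonempty)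
    (hconv : Convex ℝ X)
    (hX : enclosingRadius X = 0 ∨
      (1 < enclosingRadius X ∧
        ∃ p : Fin 3 → EuclideanSpace ℝ (Fin d), AffineIndependent ℝ p ∧ ∀ i, p i ∈ X)) :
    ((unitDistanceGraph d).induce X).Connected := by
  have : Nonempty X := hne.to_subtype
  refine (SimpleGraph.connected_iff _).2 ⟨?_, this⟩
  rintro ⟨x, hx⟩ ⟨y, hy⟩
  rcases hX with h0 | ⟨h1, p, hp, hpX⟩
  · obtain rfl := subsingleton_of_enclosingRadius_eq_zero h0 hx hy
    rfl
  obtain ⟨q, hq⟩ := hne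
  let q' : affineSpan ℝ X := ⟨q, subset_affineSpan _ _ hq⟩
  let ψ := AffineIsometryEquiv.vaddConst ℝ q'
  -- An isometric chart of the affine span by its direction, with origin at q.
  let φ := (affineSpan ℝ X).subtypeₐᵢ.comp ψ.toAffineIsometry
  have hsurj : ∀ z ∈ X, ∃ v, φ v = z := fun z hz =>
    ⟨ψ.symm ⟨z, subset_affineSpan _ _ hz⟩, by simp [φ]⟩
  have hV : 2 ≤ Module.finrank ℝ (affineSpan ℝ X).direction := by
    rw [← hp.finrank_vectorSpan (n := 2) (by simp), direction_affineSpan]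
    exact Submodule.finrank_mono (vectorSpan_mono ℝ (Set.range_subset_iff.2 hpX))
  have hconv' : Convex ℝ (φ ⁻¹' X) := hconv.affine_preimage φ.toAffineMap
  have hint : (interior (φ ⁻¹' X)).Nonempty := by
    rw [hconv'.interior_nonempty_iff_affineSpan_eq_top]
    have := AffineSubspace.comap_span ψ.toAffineEquiv (((↑) : affineSpan ℝ X → _) ⁻¹' X)
    rw [affineSpan_coe_preimage_eq_top, AffineSubspace.comap_top] at this
    exact this.symm
  obtain ⟨v, rfl⟩ := hsurj x hx
  obtain ⟨w, rfl⟩ := hsurj y hy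
  obtain ⟨_, _, h⟩ := hconv'.rel_of_dist_eq_one hV hint
    -- Membership is part of the relation, so that it is defined on the whole space.
    (P := fun v w => ∃ (hv : φ v ∈ X) (hw : φ w ∈ X),
      ((unitDistanceGraph d).induce X).Reachable ⟨φ v, hv⟩ ⟨φ w, hw⟩)
    (fun v _ => by
      obtain ⟨z, hz, hvz⟩ := exists_one_lt_dist_of_one_lt_enclosingRadius h1 (φ v)
      obtain ⟨z, rfl⟩ := hsurj z hz
      exact ⟨z, hz, by rwa [φ.dist_map] at hvz⟩)
    (fun v hv w hw hvw => ⟨hv, hw, SimpleGraph.Adj.reachable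
      (show dist (φ v) (φ w) = 1 by rw [φ.dist_map, hvw])⟩)
    (fun _ _ ⟨hv, hw, h⟩ => ⟨hw, hv, h.symm⟩)
    (fun _ _ _ ⟨hv, _, h⟩ ⟨_, hw, h'⟩ => ⟨hv, hw, h.trans h'⟩) hx hy
  exact h
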